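/- All graphs are finite, undirected, and have no loops or multiple edges. A graph is self-complementary if it is isomorphic to its complement, and it is non-empty if it has at least one vertex. For a set ${\cal H}$ of graphs, a graph is ${\cal H}$-free if it has no induced subgraph isomorphic to a graph in ${\cal H}$. $P_r$ denotes the path on $r$ vertices, and membership of a graph in ${\cal H}$ is understood up to isomorphism. The clique-width of a graph $G$ is the minimum number of labels needed to construct $G$ (up to isomorphism, ignoring the final labels) by the following four operations: (i) creating a new graph consisting of a single vertex with label $i$; (ii) taking the disjoint union of two labelled graphs; (iii) joining each vertex with label $i$ to each vertex with label $j$, where $i\neq j$; (iv) renaming label $i$ to $j$. The graph without vertices has clique-width $0$ by convention. A class of graphs has bounded clique-width if there is a constant $c$ such that every graph in the class has clique-width at most $c$. Theorem. Let ${\cal H}$ be a (possibly infinite) set of non-empty self-complementary graphs. Then the class of ${\cal H}$-free graphs has bounded clique-width if and only if $P_1\in{\cal H}$ or $P_4\in{\cal H}$. -/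

import Mathlib

universe u

/-- A finite simple graph: undirected, without loops or multiple edges. -/
structure FinGraph where
  V : Type u
  [finite : Finite V]
  graph : SimpleGraph V

namespace FinGraph

/-- The graph has at least one vertex. -/
def IsNonempty (G : FinGraph.{u}) : Prop := Nonempty G.V

/-- A graph is self-complementary if it is isomorphic to its complement. -/
def IsSelfComplementary (G : FinGraph.{u}) : Prop := Nonempty (G.graph ≃g G.graphᶜ)

/-- The path on `n` vertices belongs to the set `ℋ`; as usual for sets of graphs, membership is
understood up to isomorphism. -/
def PathMem (n : ℕ) (ℋ : Set FinGraph.{u}) : Prop :=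
  ∃ H ∈ ℋ, Nonempty (H.graph ≃g SimpleGraph.pathGraph n)

/-- The class of `ℋ`-free graphs: no induced subgraph is isomorphic to a member of `ℋ`. -/
def freeClass (ℋ : Set FinGraph.{u}) : Set FinGraph.{u} :=
  {G | ∀ H ∈ ℋ, ¬ H.graph.IsIndContained G.graph}

end FinGraph

/-- Expressions built from the four clique-width operations with labels from `Fin k`. -/
inductive CWExpr (k : ℕ) : Type
  /-- a new graph with a single vertex, labelled `i` -/
  | vertex (i : Fin k) : CWExpr k
  /-- disjoint union of two labelled graphs -/
  | union (e₁ e₂ : CWExpr k) : CWExpr k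
  /-- join every vertex labelled `i` to every vertex labelled `j`, where `i ≠ j` -/
  | join (i j : Fin k) (h : i ≠ j) (e : CWExpr k) : CWExpr k
  /-- rename label `i` to `j` -/
  | relabel (i j : Fin k) (e : CWExpr k) : CWExpr k

namespace CWExpr

/-- The vertex set of the constructed graph. -/
def Vert {k : ℕ} : CWExpr k → Type
  | vertex _ => Unit
  | union e₁ e₂ => e₁.Vert ⊕ e₂.Vert
  | join _ _ _ e => e.Vert
  | relabel _ _ e => e.Vert

/-- The labels of the vertices of the constructed graph. -/
def label {k : ℕ} : (e : CWExpr k) → e.Vert → Fin k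
  | vertex i => fun _ => i
  | union e₁ e₂ => Sum.elim e₁.label e₂.label
  | join _ _ _ e => e.label
  | relabel i j e => fun v => if e.label v = i then j else e.label v

/-- The constructed graph. -/
def graph {k : ℕ} : (e : CWExpr k) → SimpleGraph e.Vert
  | vertex _ => (⊥ : SimpleGraph Unit)
  | union e₁ e₂ => SimpleGraph.sum e₁.graph e₂.graph
  | join i j _ e => e.graph ⊔ SimpleGraph.fromRel (fun u v => e.label u = i ∧ e.label v = j)
  | relabel _ _ e => e.graph

end CWExpr

/-- `G` can be constructed with `k` labels. The graph without vertices, which none of the operations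
produces, needs no construction. -/
def ConstructibleWith (k : ℕ) {V : Type u} (G : SimpleGraph V) : Prop :=
  IsEmpty V ∨ ∃ e : CWExpr k, Nonempty (e.graph ≃g G)

/-- The clique-width: the least number of labels with which `G` can be constructed (and `⊤` if there
is no such number, which does not happen for finite graphs). -/
noncomputable def cliqueWidth {V : Type u} (G : SimpleGraph V) : ℕ∞ :=
  ⨅ (k : ℕ) (_ : ConstructibleWith k G), (k : ℕ∞)

/-- A class of graphs has bounded clique-width if one constant bounds the clique-width of all its
members. -/
def HasBoundedCliqueWidth (𝒢 : Set FinGraph.{u}) : Prop :=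
  ∃ c : ℕ, ∀ G ∈ 𝒢, cliqueWidth G.graph ≤ (c : ℕ∞)

/-!
A self-complementary graph on at least two vertices contains an induced `P₄`: it is connected
together with its complement, whereas in a `P₄`-free graph every set of at least two vertices is
disconnected in the graph or in the complement (Seinsche). If the graph is moreover bipartite, then
so is its complement, in which the two colour classes are cliques; hence it has at most four
vertices and is `P₁` or `P₄`.

So if `ℋ` contains neither `P₁` nor `P₄`, all bipartite graphs are `ℋ`-free, and their clique-width
is unbounded. Indeed, in an expression with `k` labels for the incidence graph of points and pairs
of points, descend to a subexpression holding more than `k` but at most `2k + 1` points. Two of its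
points look alike from outside, so for one of them, `i`, all pairs `{i, x}` with `x` an outside
point are in the subexpression; they have distinct neighbours outside, hence distinct labels.
Conversely, a `P₄`-free graph is assembled from single vertices by disjoint unions and complete
joins, for which two labels suffice.
-/

open SimpleGraph

section CliqueWidth

variable {V : Type u} {G : SimpleGraph V}

theorem ConstructibleWith.cliqueWidth_le {k : ℕ} (h : ConstructibleWith k G) : cliqueWidth G ≤ k :=
  iInf₂_le k h

theorem exists_constructibleWith_of_cliqueWidth_le {c : ℕ} (h : cliqueWidth G ≤ c) :
    ∃ k ≤ c, ConstructibleWith k G := by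
  have hlt : cliqueWidth G < ((c + 1 : ℕ) : ℕ∞) :=
    h.trans_lt (Nat.cast_lt.2 c.lt_succ_self)
  simp only [cliqueWidth, iInf_lt_iff, Nat.cast_lt, Nat.lt_succ_iff] at hlt
  obtain ⟨k, hk, hkc⟩ := hlt
  exact ⟨k, hkc, hk⟩

end CliqueWidth

section InducedPaths

variable {V W : Type*} {G : SimpleGraph V} {H : SimpleGraph W}

theorem pathGraph_one_isIndContained [Nonempty V] : pathGraph 1 ⊴ G :=
  ⟨⟨⟨fun _ => Classical.arbitrary V, Function.injective_of_subsingleton _⟩, by simp⟩⟩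

theorem nonempty_iso_of_isIndContained_of_card_le [Finite V] (h : H ⊴ G)
    (hcard : Nat.card V ≤ Nat.card W) : Nonempty (G ≃g H) := by
  obtain ⟨f⟩ := h
  exact ⟨(RelIso.ofSurjective f (f.injective.bijective_of_nat_card_le hcard).2).symm⟩

theorem pathGraph_four_isIndContained_of_adj {a b c d : V} (hab : G.Adj a b) (hbc : G.Adj b c)
    (hcd : G.Adj c d) (hac : ¬ G.Adj a c) (hbd : ¬ G.Adj b d) (had : ¬ G.Adj a d) :
    pathGraph 4 ⊴ G := by
  have hadj (i j : Fin 4) : G.Adj (![a, b, c, d] i) (![a, b, c, d] j) ↔ (pathGraph 4).Adj i j := by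
    fin_cases i <;> fin_cases j <;> simp [pathGraph_adj, G.adj_comm, *]
  have hinj : Function.Injective ![a, b, c, d] := by
    intro i j hij
    have htwins (k : Fin 4) : (pathGraph 4).Adj i k ↔ (pathGraph 4).Adj j k := by
      rw [← hadj, ← hadj, hij]
    -- No two vertices of `P₄` have the same neighbours.
    simp only [pathGraph_adj] at htwins
    clear hij
    revert i j
    decide
  exact ⟨⟨⟨![a, b, c, d], hinj⟩, hadj _ _⟩⟩

/-- `P₄` is self-complementary: its non-edges form the path `1, 3, 0, 2`. -/
def pathGraphFourIsoCompl : pathGraph 4 ≃g (pathGraph 4)ᶜ where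
  toFun := ![1, 3, 0, 2]
  invFun := ![2, 0, 3, 1]
  left_inv := by decide
  right_inv := by decide
  map_rel_iff' {i j} := by
    fin_cases i <;> fin_cases j <;> simp [pathGraph_adj]

theorem pathGraph_four_isIndContained_compl : pathGraph 4 ⊴ Gᶜ ↔ pathGraph 4 ⊴ G :=
  ⟨fun h => (pathGraphFourIsoCompl.isIndContained.trans h.compl).trans (by rw [compl_compl]),
    fun h => pathGraphFourIsoCompl.isIndContained.trans h.compl⟩

end InducedPaths

section Cuts

variable {V : Type*} {G : SimpleGraph V} {s A : Set V} {v : V}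

/-- `A` is a proper nonempty part of `s` that no edge of `G` joins to the rest of `s`, so that it
witnesses the disconnectedness of the subgraph induced on `s`. -/
structure IsCut (G : SimpleGraph V) (s A : Set V) : Prop where
  nonempty : A.Nonempty
  ssubset : A ⊂ s
  not_adj : ∀ a ∈ A, ∀ b ∈ s \ A, ¬ G.Adj a b

theorem IsCut.nonempty_diff (h : IsCut G s A) : (s \ A).Nonempty :=
  Set.nonempty_of_ssubset h.ssubset

theorem IsCut.diff (h : IsCut G s A) : IsCut G s (s \ A) where
  nonempty := h.nonempty_diff
  ssubset := h.ssubset.subset.sdiff_ssubset_of_nonempty h.nonempty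
  not_adj a ha b hb hab :=
    h.not_adj b (by simpa [hb.1] using hb.2) a ha hab.symm

theorem IsCut.not_preconnected (h : IsCut G Set.univ A) : ¬ G.Preconnected := by
  intro hG
  obtain ⟨a, ha⟩ := h.nonempty
  obtain ⟨b, hb⟩ := h.nonempty_diff
  obtain ⟨p⟩ := hG a b
  obtain ⟨d, -, hd₁, hd₂⟩ := p.exists_boundary_dart A ha hb.2
  exact h.not_adj _ hd₁ _ ⟨trivial, hd₂⟩ d.adj

theorem isCut_singleton_insert (hs : s.Nonempty) (hv : v ∉ s) (h : ∀ x ∈ s, ¬ G.Adj v x) :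
    IsCut G (insert v s) {v} where
  nonempty := Set.singleton_nonempty v
  ssubset := by
    obtain ⟨x, hx⟩ := hs
    refine ⟨by simp, fun hsub => hv ?_⟩
    rwa [← hsub (Set.mem_insert_of_mem v hx)]
  not_adj := by
    rintro _ rfl b ⟨rfl | hb, hne⟩
    · exact (hne rfl).elim
    · exact h b hb

theorem IsCut.insert_of_forall_not_adj (h : IsCut G s A) (hv : v ∉ s) (hvA : ∀ a ∈ A, ¬ G.Adj v a) :
    IsCut G (insert v s) A where
  nonempty := h.nonempty
  ssubset := h.ssubset.trans (Set.ssubset_insert hv)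
  not_adj := by
    rintro a ha b ⟨rfl | hb, hbA⟩ hab
    · exact hvA a ha hab.symm
    · exact h.not_adj a ha b ⟨hb, hbA⟩ hab

theorem IsCut.insert_of_adj (hP : ¬ pathGraph 4 ⊴ G) (h : IsCut G s A) (hv : v ∉ s)
    {y z : V} (hy : y ∈ A) (hvy : ¬ G.Adj v y) (hz : z ∈ s \ A) (hvz : G.Adj v z) :
    IsCut G (insert v s) {a ∈ A | ¬ G.Adj v a} where
  nonempty := ⟨y, hy, hvy⟩
  ssubset := ((Set.sep_subset A _).trans_ssubset h.ssubset).trans (Set.ssubset_insert hv)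
  not_adj := by
    rintro a ⟨ha, hva⟩ b ⟨rfl | hb, hbA⟩ hab
    · exact hva hab.symm
    by_cases hbA' : b ∈ A
    · have hvb : G.Adj v b := by_contra fun hvb => hbA ⟨hbA', hvb⟩
      exact hP (pathGraph_four_isIndContained_of_adj hab hvb.symm hvz (fun hav => hva hav.symm)
        (h.not_adj b hbA' z hz) (h.not_adj a ha z hz))
    · exact h.not_adj a ha b ⟨hb, hbA'⟩ hab

theorem IsCut.exists_insert (hP : ¬ pathGraph 4 ⊴ G) (h : IsCut G s A) (hv : v ∉ s) :
    ∃ B, IsCut G (insert v s) B ∨ IsCut Gᶜ (insert v s) B := by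
  by_cases hall : ∀ x ∈ s, G.Adj v x
  · exact ⟨{v}, .inr (isCut_singleton_insert (h.nonempty.mono h.ssubset.subset) hv
      fun x hx hvx => hvx.2 (hall x hx))⟩
  push Not at hall
  obtain ⟨y, hys, hvy⟩ := hall
  wlog hyA : y ∈ A generalizing A
  · exact this h.diff ⟨hys, hyA⟩
  by_cases hadj : ∃ z ∈ s \ A, G.Adj v z
  · obtain ⟨z, hz, hvz⟩ := hadj
    exact ⟨_, .inl (h.insert_of_adj hP hv hyA hvy hz hvz)⟩
  · push Not at hadj
    exact ⟨_, .inl (h.diff.insert_of_forall_not_adj hv hadj)⟩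

theorem exists_isCut_or_isCut_compl (hP : ¬ pathGraph 4 ⊴ G) (hfin : s.Finite)
    (hs : s.Nontrivial) : ∃ A, IsCut G s A ∨ IsCut Gᶜ s A := by
  induction s, hfin using Set.Finite.induction_on with
  | empty => exact (Set.not_nontrivial_empty hs).elim
  | @insert v s hv _ ih =>
    rcases s.subsingleton_or_nontrivial with hsub | hnt
    · obtain rfl | ⟨w, rfl⟩ := hsub.eq_empty_or_singleton
      · simp at hs
      refine ⟨{v}, ?_⟩
      by_cases hadj : G.Adj v w
      · exact .inr (isCut_singleton_insert (Set.singleton_nonempty w) hv (by simp [hadj]))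
      · exact .inl (isCut_singleton_insert (Set.singleton_nonempty w) hv (by simp [hadj]))
    · obtain ⟨A, hA | hA⟩ := ih hnt
      · exact hA.exists_insert hP hv
      · obtain ⟨B, hB⟩ := hA.exists_insert (mt pathGraph_four_isIndContained_compl.1 hP) hv
        exact ⟨B, by rwa [compl_compl, or_comm] at hB⟩

theorem pathGraph_four_isIndContained_of_connected [Finite V] [Nontrivial V] (hG : G.Connected)
    (hGc : Gᶜ.Connected) : pathGraph 4 ⊴ G := by
  by_contra hP
  obtain ⟨A, hA | hA⟩ := exists_isCut_or_isCut_compl hP Set.finite_univ Set.nontrivial_univ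
  · exact hA.not_preconnected hG.preconnected
  · exact hA.not_preconnected hGc.preconnected

end Cuts

section SelfComplementary

variable {V : Type*} {G : SimpleGraph V}

theorem pathGraph_four_isIndContained_of_iso_compl [Finite V] [Nontrivial V] (φ : G ≃g Gᶜ) :
    pathGraph 4 ⊴ G := by
  have hG : G.Connected := G.connected_or_connected_compl.elim id φ.connected_iff.2
  exact pathGraph_four_isIndContained_of_connected hG (φ.connected_iff.1 hG)

theorem card_le_mul_of_colorable_of_colorable_compl {m n : ℕ} (hG : G.Colorable m)
    (hGc : Gᶜ.Colorable n) : Nat.card V ≤ m * n := by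
  obtain ⟨C⟩ := hG
  obtain ⟨D⟩ := hGc
  have hinj : Function.Injective fun v => (C v, D v) := by
    intro u v huv
    obtain ⟨hC, hD⟩ := Prod.mk.inj huv
    by_contra hne
    by_cases hadj : G.Adj u v
    · exact C.valid hadj hC
    · exact D.valid ⟨hne, hadj⟩ hD
  simpa using Nat.card_le_card_of_injective _ hinj

theorem nonempty_iso_pathGraph_of_isBipartite_of_iso_compl [Finite V] [Nonempty V]
    (hG : G.IsBipartite) (φ : G ≃g Gᶜ) :
    Nonempty (G ≃g pathGraph 1) ∨ Nonempty (G ≃g pathGraph 4) := by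
  rcases subsingleton_or_nontrivial V with _ | _
  · exact .inl (nonempty_iso_of_isIndContained_of_card_le pathGraph_one_isIndContained (by simp))
  · have hcard : Nat.card V ≤ 2 * 2 :=
      card_le_mul_of_colorable_of_colorable_compl hG (hG.of_hom φ.symm.toHom)
    exact .inr (nonempty_iso_of_isIndContained_of_card_le
      (pathGraph_four_isIndContained_of_iso_compl φ) (by simpa using hcard))

end SelfComplementary

namespace CWExpr

variable {k : ℕ} {i j : Fin k} {h : i ≠ j} {e : CWExpr k} {u v : e.Vert}

theorem join_adj :
    (join i j h e).graph.Adj u v ↔ e.graph.Adj u v ∨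
      u ≠ v ∧ (e.label u = i ∧ e.label v = j ∨ e.label v = i ∧ e.label u = j) :=
  Iff.rfl

theorem join_adj_of_label_eq (hu : e.label u = i) (hv : e.label v = j) :
    (join i j h e).graph.Adj u v :=
  .inr ⟨fun huv => h (by rw [← hu, ← hv, huv]), .inl ⟨hu, hv⟩⟩

theorem join_adj_iff_of_label_eq (huv : e.label u = e.label v) :
    (join i j h e).graph.Adj u v ↔ e.graph.Adj u v := by
  rw [join_adj, huv]
  grind

end CWExpr

section Cographs

variable {V : Type*} {G : SimpleGraph V} {s t A : Set V}

/-- The subgraph of `G` induced on `s` can be constructed with the labels `0` and `1` in such a way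
that all its vertices end up with label `0`. This is the invariant that lets constructed pieces be
combined by disjoint union and by complete join without a third label. -/
def IsBuiltWithTwoLabels (G : SimpleGraph V) (s : Set V) : Prop :=
  ∃ (e : CWExpr 2) (f : e.graph ↪g G), Set.range f = s ∧ ∀ v, e.label v = 0

theorem IsBuiltWithTwoLabels.singleton (v : V) : IsBuiltWithTwoLabels G {v} := by
  refine ⟨.vertex 0, ⟨⟨fun _ => v, fun _ _ _ => rfl⟩, iff_of_false G.irrefl id⟩, ?_, fun _ => rfl⟩
  exact Set.range_const (ι := Unit)

theorem IsBuiltWithTwoLabels.union (hs : IsBuiltWithTwoLabels G s) (ht : IsBuiltWithTwoLabels G t)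
    (hst : Disjoint s t) (hadj : ∀ a ∈ s, ∀ b ∈ t, ¬ G.Adj a b) :
    IsBuiltWithTwoLabels G (s ∪ t) := by
  obtain ⟨e₁, f₁, rfl, hlabel₁⟩ := hs
  obtain ⟨e₂, f₂, rfl, hlabel₂⟩ := ht
  have hcross (a : e₁.Vert) (b : e₂.Vert) : ¬ G.Adj (f₁ a) (f₂ b) := hadj _ ⟨a, rfl⟩ _ ⟨b, rfl⟩
  refine ⟨.union e₁ e₂, ⟨⟨Sum.elim f₁ f₂, ?_⟩, ?_⟩, Set.Sum.elim_range f₁ f₂, ?_⟩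
  · exact f₁.injective.sumElim f₂.injective fun a b =>
      hst.ne_of_mem (Set.mem_range_self a) (Set.mem_range_self b)
  · rintro (a | a) (b | b)
    · exact f₁.map_adj_iff.trans sum_adj_inl.symm
    · exact iff_of_false (hcross a b) (not_adj_sum_inl_inr a b)
    · exact iff_of_false (fun h => hcross b a h.symm) fun h => not_adj_sum_inl_inr b a h.symm
    · exact f₂.map_adj_iff.trans sum_adj_inr.symm
  · rintro (v | v)
    exacts [hlabel₁ v, hlabel₂ v]

theorem IsBuiltWithTwoLabels.join (hs : IsBuiltWithTwoLabels G s) (ht : IsBuiltWithTwoLabels G t)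
    (hst : Disjoint s t) (hadj : ∀ a ∈ s, ∀ b ∈ t, G.Adj a b) :
    IsBuiltWithTwoLabels G (s ∪ t) := by
  obtain ⟨e₁, f₁, rfl, hlabel₁⟩ := hs
  obtain ⟨e₂, f₂, rfl, hlabel₂⟩ := ht
  have hcross (a : e₁.Vert) (b : e₂.Vert) : G.Adj (f₁ a) (f₂ b) := hadj _ ⟨a, rfl⟩ _ ⟨b, rfl⟩
  let e : CWExpr 2 := .union e₁ (.relabel 0 1 e₂)
  have hinl (a : e₁.Vert) : e.label (.inl a) = 0 := hlabel₁ a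
  have hinr (b : e₂.Vert) : e.label (.inr b) = 1 := if_pos (hlabel₂ b)
  refine ⟨.relabel 1 0 (.join 0 1 zero_ne_one e), ⟨⟨Sum.elim f₁ f₂, ?_⟩, ?_⟩,
    Set.Sum.elim_range f₁ f₂, ?_⟩
  · exact f₁.injective.sumElim f₂.injective fun a b =>
      hst.ne_of_mem (Set.mem_range_self a) (Set.mem_range_self b)
  · rintro (a | a) (b | b)
    · exact f₁.map_adj_iff.trans (sum_adj_inl.symm.trans
        (CWExpr.join_adj_iff_of_label_eq ((hinl a).trans (hinl b).symm)).symm)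
    · exact iff_of_true (hcross a b) (CWExpr.join_adj_of_label_eq (hinl a) (hinr b))
    · exact iff_of_true (hcross b a).symm (CWExpr.join_adj_of_label_eq (hinl b) (hinr a)).symm
    · exact f₂.map_adj_iff.trans (sum_adj_inr.symm.trans
        (CWExpr.join_adj_iff_of_label_eq ((hinr a).trans (hinr b).symm)).symm)
  · rintro (v | v)
    · exact (if_neg fun h => zero_ne_one ((hinl v).symm.trans h)).trans (hinl v)
    · exact if_pos (hinr v)

theorem IsBuiltWithTwoLabels.of_isCut (hcut : IsCut G s A ∨ IsCut Gᶜ s A)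
    (hA : IsBuiltWithTwoLabels G A) (hdiff : IsBuiltWithTwoLabels G (s \ A)) :
    IsBuiltWithTwoLabels G s := by
  have hsub : A ⊆ s := hcut.elim (·.ssubset.subset) (·.ssubset.subset)
  rw [← Set.union_sdiff_cancel hsub]
  rcases hcut with h | h
  · exact hA.union hdiff Set.disjoint_sdiff_right h.not_adj
  · refine hA.join hdiff Set.disjoint_sdiff_right fun a ha b hb => ?_
    by_contra hab
    exact h.not_adj a ha b hb ⟨Set.disjoint_sdiff_right.ne_of_mem ha hb, hab⟩

theorem isBuiltWithTwoLabels_of_not_pathGraph_four_isIndContained (hP : ¬ pathGraph 4 ⊴ G)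
    (hfin : s.Finite) (hs : s.Nonempty) : IsBuiltWithTwoLabels G s := by
  induction hn : s.ncard using Nat.strong_induction_on generalizing s with
  | _ n ih =>
    obtain ⟨v, rfl⟩ | hnt := hs.exists_eq_singleton_or_nontrivial
    · exact .singleton v
    have hpart {B : Set V} (hB : B.Nonempty) (hBs : B ⊂ s) : IsBuiltWithTwoLabels G B :=
      ih _ (hn ▸ Set.ncard_lt_ncard hBs hfin) (hfin.subset hBs.subset) hB rfl
    obtain ⟨A, hA⟩ := exists_isCut_or_isCut_compl hP hfin hnt
    have hparts {H : SimpleGraph V} (h : IsCut H s A) :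
        IsBuiltWithTwoLabels G A ∧ IsBuiltWithTwoLabels G (s \ A) :=
      ⟨hpart h.nonempty h.ssubset, hpart h.diff.nonempty h.diff.ssubset⟩
    obtain ⟨hbuilt, hbuilt_diff⟩ := hA.elim hparts hparts
    exact .of_isCut hA hbuilt hbuilt_diff

theorem constructibleWith_two_of_not_pathGraph_four_isIndContained [Finite V]
    (hP : ¬ pathGraph 4 ⊴ G) : ConstructibleWith 2 G := by
  rcases isEmpty_or_nonempty V with hV | _
  · exact .inl hV
  · obtain ⟨e, f, hf, -⟩ := isBuiltWithTwoLabels_of_not_pathGraph_four_isIndContained hP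
      Set.finite_univ Set.univ_nonempty
    exact .inr ⟨e, ⟨RelIso.ofSurjective f (Set.range_eq_univ.1 hf)⟩⟩

end Cographs

section BalancedSets

variable {V W κ : Type*} {G : SimpleGraph V} {H : SimpleGraph W} {S : Set V} {ℓ : V → κ}

/-- Vertices of `S` with the same value of `ℓ` have the same neighbours outside `S`; when `ℓ` takes
few values, `S` is attached to the rest of `G` in few ways. -/
def DeterminesOutsideAdj (G : SimpleGraph V) (S : Set V) (ℓ : V → κ) : Prop :=
  ∀ ⦃u⦄, u ∈ S → ∀ ⦃v⦄, v ∈ S → ℓ u = ℓ v → ∀ ⦃w⦄, w ∉ S → (G.Adj u w ↔ G.Adj v w)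

theorem DeterminesOutsideAdj.preimage (h : DeterminesOutsideAdj G S ℓ) (f : H ↪g G) :
    DeterminesOutsideAdj H (f ⁻¹' S) (ℓ ∘ f) :=
  fun _ hu _ hv huv _ hw => f.map_adj_iff.symm.trans ((h hu hv huv hw).trans f.map_adj_iff)

theorem ncard_inter_image {f : V → W} (hf : Function.Injective f) (A : Set W) (S : Set V) :
    (A ∩ f '' S).ncard = (f ⁻¹' A ∩ S).ncard := by
  rw [← Set.image_preimage_inter, Set.ncard_image_of_injective _ hf]

theorem le_ncard_preimage_inl_or_le_ncard_preimage_inr {A : Set (V ⊕ W)} {t : ℕ}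
    (hA : 2 * t ≤ A.ncard) : t ≤ (Sum.inl ⁻¹' A).ncard ∨ t ≤ (Sum.inr ⁻¹' A).ncard := by
  have hunion := Set.ncard_union_le (Sum.inl '' (Sum.inl ⁻¹' A)) (Sum.inr '' (Sum.inr ⁻¹' A))
  rw [Set.image_preimage_inl_union_image_preimage_inr,
    Set.ncard_image_of_injective _ Sum.inl_injective,
    Set.ncard_image_of_injective _ Sum.inr_injective] at hunion
  omega

namespace CWExpr

variable {k : ℕ} {e e₁ e₂ : CWExpr k}

/-- Vertices of `S` with the same value of `ℓ` have the same final label and the same neighbours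
outside `S`. This holds for the vertex set of any subexpression, `ℓ` being the labelling at the
moment the subexpression is completed: later operations treat equally labelled vertices alike. -/
structure DeterminesOutside (e : CWExpr k) (S : Set e.Vert) (ℓ : e.Vert → Fin k) : Prop where
  label_eq : ∀ ⦃u⦄, u ∈ S → ∀ ⦃v⦄, v ∈ S → ℓ u = ℓ v → e.label u = e.label v
  determinesOutsideAdj : DeterminesOutsideAdj e.graph S ℓ

theorem determinesOutside_univ : e.DeterminesOutside Set.univ e.label where
  label_eq _ _ _ _ huv := huv
  determinesOutsideAdj _ _ _ _ _ _ hw := (hw trivial).elim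

theorem DeterminesOutside.union_inl {S : Set e₁.Vert} {ℓ : e₁.Vert → Fin k}
    (h : e₁.DeterminesOutside S ℓ) :
    (union e₁ e₂).DeterminesOutside (Sum.inl '' S) (Sum.elim ℓ e₂.label) where
  label_eq := by
    rintro _ ⟨u, hu, rfl⟩ _ ⟨v, hv, rfl⟩ huv
    exact h.label_eq hu hv huv
  determinesOutsideAdj := by
    rintro _ ⟨u, hu, rfl⟩ _ ⟨v, hv, rfl⟩ huv (w | w) hw
    · exact sum_adj_inl.trans ((h.determinesOutsideAdj hu hv huv
        fun hwS => hw ⟨w, hwS, rfl⟩).trans sum_adj_inl.symm)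
    · exact iff_of_false (not_adj_sum_inl_inr u w) (not_adj_sum_inl_inr v w)

theorem DeterminesOutside.union_inr {S : Set e₂.Vert} {ℓ : e₂.Vert → Fin k}
    (h : e₂.DeterminesOutside S ℓ) :
    (union e₁ e₂).DeterminesOutside (Sum.inr '' S) (Sum.elim e₁.label ℓ) where
  label_eq := by
    rintro _ ⟨u, hu, rfl⟩ _ ⟨v, hv, rfl⟩ huv
    exact h.label_eq hu hv huv
  determinesOutsideAdj := by
    rintro _ ⟨u, hu, rfl⟩ _ ⟨v, hv, rfl⟩ huv (w | w) hw
    · exact iff_of_false (fun h => not_adj_sum_inl_inr w u h.symm)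
        fun h => not_adj_sum_inl_inr w v h.symm
    · exact sum_adj_inr.trans ((h.determinesOutsideAdj hu hv huv
        fun hwS => hw ⟨w, hwS, rfl⟩).trans sum_adj_inr.symm)

theorem DeterminesOutside.join {S : Set e.Vert} {ℓ : e.Vert → Fin k} {i j : Fin k} {hij : i ≠ j}
    (h : e.DeterminesOutside S ℓ) : (join i j hij e).DeterminesOutside S ℓ where
  label_eq := h.label_eq
  determinesOutsideAdj u hu v hv huv w hw := by
    have huw : u ≠ w := ne_of_mem_of_not_mem hu hw
    have hvw : v ≠ w := ne_of_mem_of_not_mem hv hw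
    refine join_adj.trans (Iff.trans ?_ join_adj.symm)
    rw [h.determinesOutsideAdj hu hv huv hw, h.label_eq hu hv huv]
    exact or_congr_right (and_congr_left' (iff_of_true huw hvw))

theorem DeterminesOutside.relabel {S : Set e.Vert} {ℓ : e.Vert → Fin k} {i j : Fin k}
    (h : e.DeterminesOutside S ℓ) : (relabel i j e).DeterminesOutside S ℓ where
  label_eq _ hu _ hv huv :=
    congrArg (fun l => if l = i then j else l) (h.label_eq hu hv huv)
  determinesOutsideAdj := h.determinesOutsideAdj

theorem exists_determinesOutside_ncard_mem_Ico {t : ℕ} (ht : 0 < t) (e : CWExpr k)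
    (A : Set e.Vert) (hA : t ≤ A.ncard) :
    ∃ S ℓ, e.DeterminesOutside S ℓ ∧ (A ∩ S).ncard ∈ Set.Ico t (2 * t) := by
  have of_lt {e : CWExpr k} {A : Set e.Vert} (hA : t ≤ A.ncard) (hlt : A.ncard < 2 * t) :
      ∃ S ℓ, e.DeterminesOutside S ℓ ∧ (A ∩ S).ncard ∈ Set.Ico t (2 * t) :=
    ⟨Set.univ, e.label, determinesOutside_univ, by simp [hA, hlt]⟩
  induction e with
  | vertex i =>
    have hle : A.ncard ≤ 1 := Set.ncard_le_one_of_subsingleton (α := Unit) A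
    exact of_lt hA (by omega)
  | union e₁ e₂ ih₁ ih₂ =>
    by_cases hlt : A.ncard < 2 * t
    · exact of_lt hA hlt
    obtain hinl | hinr := le_ncard_preimage_inl_or_le_ncard_preimage_inr (not_lt.1 hlt)
    · obtain ⟨S, ℓ, h, hcard⟩ := ih₁ _ hinl
      exact ⟨_, _, h.union_inl, (ncard_inter_image Sum.inl_injective A S).symm ▸ hcard⟩
    · obtain ⟨S, ℓ, h, hcard⟩ := ih₂ _ hinr
      exact ⟨_, _, h.union_inr, (ncard_inter_image Sum.inr_injective A S).symm ▸ hcard⟩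
  | join i j hij e ih =>
    obtain ⟨S, ℓ, h, hcard⟩ := ih A hA
    exact ⟨S, ℓ, h.join, hcard⟩
  | relabel i j e ih =>
    obtain ⟨S, ℓ, h, hcard⟩ := ih A hA
    exact ⟨S, ℓ, h.relabel, hcard⟩

end CWExpr

theorem ConstructibleWith.exists_determinesOutsideAdj_ncard_mem_Ico {V : Type u}
    {G : SimpleGraph V} {k t : ℕ} (hG : ConstructibleWith k G) (ht : 0 < t) (A : Set V)
    (hA : t ≤ A.ncard) :
    ∃ (S : Set V) (ℓ : V → Fin k), DeterminesOutsideAdj G S ℓ ∧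
      (A ∩ S).ncard ∈ Set.Ico t (2 * t) := by
  obtain _ | ⟨e, ⟨φ⟩⟩ := hG
  · rw [A.eq_empty_of_isEmpty, Set.ncard_empty] at hA
    omega
  · let f : G ↪g e.graph := φ.symm.toEmbedding
    obtain ⟨S, ℓ, h, hcard⟩ := e.exists_determinesOutside_ncard_mem_Ico ht (f '' A)
      (by rwa [Set.ncard_image_of_injective _ f.injective])
    refine ⟨_, _, h.determinesOutsideAdj.preimage f, ?_⟩
    rwa [Set.inter_comm, ← ncard_inter_image f.injective, Set.inter_comm]

end BalancedSets

section IncidenceGraph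

variable {α κ : Type*}

/-- The bipartite incidence graph between the points of `α` and the unordered pairs of points. The
degenerate pairs `s(i, i)` are kept, which adds a pendant vertex at every point. It serves as a
bipartite graph of large clique-width. -/
def incidenceGraph (α : Type*) : SimpleGraph (α ⊕ Sym2 α) where
  Adj
    | .inl i, .inr p | .inr p, .inl i => i ∈ p
    | _, _ => False
  symm := ⟨by rintro (i | p) (j | q) h <;> exact h⟩
  loopless := ⟨by rintro (i | p) h <;> exact h⟩

theorem isBipartite_incidenceGraph : (incidenceGraph α).IsBipartite :=
  ⟨Coloring.mk (Sum.elim (fun _ => 0) fun _ => 1) (by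
    rintro (i | p) (j | q) h
    exacts [h.elim, zero_ne_one, one_ne_zero, h.elim])⟩

variable {S : Set (α ⊕ Sym2 α)} {ℓ : α ⊕ Sym2 α → κ}

theorem DeterminesOutsideAdj.pair_mem (h : DeterminesOutsideAdj (incidenceGraph α) S ℓ)
    {i j x : α} (hi : .inl i ∈ S) (hj : .inl j ∈ S) (hij : i ≠ j) (hℓ : ℓ (.inl i) = ℓ (.inl j))
    (hx : .inl x ∉ S) : .inr s(i, x) ∈ S := by
  by_contra hp
  have hjp : j ∈ s(i, x) := (h hi hj hℓ hp).1 (Sym2.mem_mk_left i x)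
  obtain rfl | rfl := Sym2.mem_iff.1 hjp
  exacts [hij rfl, hx hj]

theorem DeterminesOutsideAdj.eq_of_pair_mem (h : DeterminesOutsideAdj (incidenceGraph α) S ℓ)
    {i x y : α} (hi : .inl i ∈ S) (hx : .inl x ∉ S) (hix : .inr s(i, x) ∈ S)
    (hiy : .inr s(i, y) ∈ S) (hℓ : ℓ (.inr s(i, x)) = ℓ (.inr s(i, y))) : x = y := by
  have hxp : x ∈ s(i, y) := (h hix hiy hℓ hx).1 (Sym2.mem_mk_right i x)
  obtain rfl | rfl := Sym2.mem_iff.1 hxp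
  exacts [(hx hi).elim, rfl]

theorem DeterminesOutsideAdj.ncard_compl_points_le [Finite κ]
    (h : DeterminesOutsideAdj (incidenceGraph α) S ℓ)
    (hcard : Nat.card κ < (Sum.inl ⁻¹' S).ncard) : (Sum.inl ⁻¹' S)ᶜ.ncard ≤ Nat.card κ := by
  rw [← Set.ncard_univ] at hcard ⊢
  obtain ⟨i, hi, j, hj, hij, hℓ⟩ :=
    Set.exists_ne_map_eq_of_ncard_lt_of_maps_to hcard (Set.mapsTo_univ (fun i => ℓ (.inl i)) _)
  have hpair (x : α) (hx : x ∈ (Sum.inl ⁻¹' S)ᶜ) : .inr s(i, x) ∈ S := h.pair_mem hi hj hij hℓ hx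
  exact Set.ncard_le_ncard_of_injOn (fun x => ℓ (.inr s(i, x))) (fun _ _ => trivial)
    fun x hx y hy hxy => h.eq_of_pair_mem hi hx (hpair x hx) (hpair y hy) hxy

theorem ConstructibleWith.card_le_of_incidenceGraph {α : Type u} [Finite α] {k : ℕ}
    (h : ConstructibleWith k (incidenceGraph α)) : Nat.card α ≤ 3 * k + 1 := by
  by_contra! hlt
  have hpoints : (Set.range (Sum.inl : α → α ⊕ Sym2 α)).ncard = Nat.card α := by
    rw [← Set.image_univ, Set.ncard_image_of_injective _ Sum.inl_injective, Set.ncard_univ]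
  obtain ⟨S, ℓ, hS, hcard⟩ :=
    h.exists_determinesOutsideAdj_ncard_mem_Ico k.succ_pos (Set.range Sum.inl) (by omega)
  rw [← Set.image_preimage_eq_range_inter, Set.ncard_image_of_injective _ Sum.inl_injective]
    at hcard
  obtain ⟨hlower, hupper⟩ := hcard
  have hcompl := hS.ncard_compl_points_le (by rw [Nat.card_fin]; omega)
  rw [Nat.card_fin] at hcompl
  have hsum := Set.ncard_add_ncard_compl (Sum.inl ⁻¹' S : Set α)
  omega

end IncidenceGraph

namespace FinGraph

variable {ℋ : Set FinGraph.{u}} {G : FinGraph.{u}}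

theorem PathMem.not_isIndContained {n : ℕ} (h : PathMem n ℋ) (hG : G ∈ freeClass ℋ) :
    ¬ pathGraph n ⊴ G.graph := by
  obtain ⟨H, hH, ⟨φ⟩⟩ := h
  exact fun hP => hG H hH (φ.isIndContained.trans hP)

theorem mem_freeClass_of_isBipartite (hne : ∀ H ∈ ℋ, H.IsNonempty)
    (hsc : ∀ H ∈ ℋ, H.IsSelfComplementary) (hP₁ : ¬ PathMem 1 ℋ) (hP₄ : ¬ PathMem 4 ℋ)
    (hG : G.graph.IsBipartite) : G ∈ freeClass ℋ := by
  rintro H hH ⟨f⟩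
  have := H.finite
  have : Nonempty H.V := hne H hH
  obtain ⟨φ⟩ := hsc H hH
  rcases nonempty_iso_pathGraph_of_isBipartite_of_iso_compl (hG.of_hom f.toHom) φ with h | h
  · exact hP₁ ⟨H, hH, h⟩
  · exact hP₄ ⟨H, hH, h⟩

end FinGraph

theorem mainTheorem4 (ℋ : Set FinGraph.{u})
    (hne : ∀ H ∈ ℋ, H.IsNonempty) (hsc : ∀ H ∈ ℋ, H.IsSelfComplementary) :
    HasBoundedCliqueWidth (FinGraph.freeClass ℋ) ↔
      FinGraph.PathMem 1 ℋ ∨ FinGraph.PathMem 4 ℋ := by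
  constructor
  · rintro ⟨c, hc⟩
    by_contra! hP
    let G : FinGraph.{u} := ⟨_, incidenceGraph (ULift (Fin (3 * c + 2)))⟩
    have hG : G ∈ FinGraph.freeClass ℋ :=
      FinGraph.mem_freeClass_of_isBipartite hne hsc hP.1 hP.2 isBipartite_incidenceGraph
    obtain ⟨k, hk, hcon⟩ := exists_constructibleWith_of_cliqueWidth_le (hc G hG)
    have hcard := hcon.card_le_of_incidenceGraph
    simp only [Nat.card_eq_fintype_card, Fintype.card_ulift, Fintype.card_fin] at hcard
    omega
  · rintro (hP₁ | hP₄)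
    · refine ⟨0, fun G hG => ConstructibleWith.cliqueWidth_le (.inl ⟨fun v => ?_⟩)⟩
      have : Nonempty G.V := ⟨v⟩
      exact hP₁.not_isIndContained hG pathGraph_one_isIndContained
    · refine ⟨2, fun G hG => ConstructibleWith.cliqueWidth_le ?_⟩
      have := G.finite
      exact constructibleWith_two_of_not_pathGraph_four_isIndContained (hP₄.not_isIndContained hG)
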